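/- Let $d\ge 2$ be an integer. For $x\in[0,1]^d$ let $A(x)=[0,x_1]\times\cdots\times[0,x_d]$ be the anchored box with corner $x$. For a finite set $P\subset[0,1]^d$ let $\mathcal A_d(P)=\{A(x)\cap P: x\in[0,1]^d\}$ be the system of subsets of $P$ induced by anchored boxes, and for $F\in\mathcal A_d(P)$ let $\overline w(F)=\lambda^d(\{x\in[0,1]^d: A(x)\cap P=F\})$, where $\lambda^d$ is the $d$-dimensional Lebesgue measure. The weighted combinatorial $L_2$-discrepancy of $\mathcal A_d(P)$ is $$\mathrm{disc}_{2,\overline w}\,\mathcal A_d(P)=\min_{\chi\in\{-1,1\}^P}\Bigl(\frac{1}{\overline w(\mathcal A_d(P))}\sum_{F\in\mathcal A_d(P)}\overline w(F)\,\bigl|\chi(F)\bigr|^2\Bigr)^{1/2},$$ where $\chi(F)=\sum_{q\in F}\chi(q)$ and $\overline w(\mathcal A_d(P))=\sum_{F\in\mathcal A_d(P)}\overline w(F)$. Then there is a constant $c>0$, depending only on $d$, such that for infinitely many $n\in\mathbb N$ there exists an $n$-point set $P\subset[0,1]^d$ with $$\mathrm{disc}_{2,\overline w}\,\mathcal A_d(P)\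 \ge\ c\,(\log n)^{d-1}.$$ -/

import Mathlib

open Classical in
/-- The weighted combinatorial `L_p`-discrepancy of a set system `S` on a finite ground set `V`,
with weights `w`: the minimum over all colorings `χ ∈ {-1, 1}^V` of
`((1 / w(S)) * ∑_{F ∈ S} w(F) |χ(F)|^p)^(1/p)`, where `χ(F) = ∑_{j ∈ F} χ_j` and
`w(S) = ∑_{F ∈ S} w(F)`. -/
noncomputable def weightedLpDisc {V : Type*} [Fintype V] (p : ℝ) (S : Finset (Finset V))
    (w : Finset V → ℝ) : ℝ :=
  (Fintype.piFinset fun _ : V => ({-1, 1} : Finset ℝ)).inf'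
    ⟨fun _ => 1, by simp⟩
    fun χ => (1 / (∑ F ∈ S, w F) * ∑ F ∈ S, w F * |∑ j ∈ F, χ j| ^ p) ^ (1 / p)

/-- The anchored box `A(x) = [0, x₁] × ⋯ × [0, x_d]` with corner `x`. -/
def anchoredBox {d : ℕ} (x : Fin d → ℝ) : Set (Fin d → ℝ) :=
  Set.Icc 0 x

open Classical in
/-- The intersection `A(x) ∩ P`, as a subset of the ground set `P`. -/
noncomputable def boxTrace {d : ℕ} (P : Finset (Fin d → ℝ)) (x : Fin d → ℝ) : Finset P :=
  Finset.univ.filter fun q : P => (q : Fin d → ℝ) ∈ anchoredBox x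

open Classical in
/-- The system of all intersections of `P ⊆ [0,1]^d` with anchored boxes `A(x)`,
`x ∈ [0,1]^d`. -/
noncomputable def anchoredSystem {d : ℕ} (P : Finset (Fin d → ℝ)) : Finset (Finset P) :=
  Finset.univ.filter fun F : Finset P => ∃ x ∈ Set.Icc (0 : Fin d → ℝ) 1, boxTrace P x = F

/-- The weight of `F ⊆ P`: the Lebesgue measure of the set of all corners `x ∈ [0,1]^d` whose
anchored box `A(x)` intersects `P` exactly in `F`. -/
noncomputable def cornerWeight {d : ℕ} (P : Finset (Fin d → ℝ)) (F : Finset P) : ℝ :=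
  (MeasureTheory.volume {x : Fin d → ℝ | x ∈ Set.Icc (0 : Fin d → ℝ) 1 ∧ boxTrace P x = F}).toReal

/-! On the grid of side `m = 4 ^ (L + 1)`, let `N = m ^ d` and attach to each point `p` the vector
`dominating p` of corners above it. Signed sums of these vectors are the discrepancies at all grid
corners, so `S` has large L2 discrepancy once every signed sum over `S` has squared norm of order `N
* L ^ (2 * (d - 1))`.

Two orthonormal families indexed by 4-adic boxes of relative volume `4 ^ (-L)` diagonalize the
dominance form, with every diagonal entry `σ = 4 ^ (d * L - L) / 2 ^ d`
(`sum_haar_mul_inner_bump_dominating`). Hence the form is bounded below by `σ` on a space whose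
dimension is of order `L ^ (d - 1) * 4 ^ L`. With `k` half of that dimension, averaging yields `k`
grid points, each of whose vectors has distance at least `δ = σ * √(k / N)` to the span of the
earlier ones (`exists_far_from_subspace`, `exists_greedy_sequence`).

Such a sequence has a subfamily all of whose signed sums have squared norm at least a constant times
`δ ^ 2 * k` (`exists_subset_signed_sum_large`). Otherwise bitwise rounding would bring every point
of `{0, ..., 31} ^ k` close to one of only `2 ^ k` vertices, and a volume count forbids this.
Dividing by `N` leaves `(σ * k / N) ^ 2`, of order `L ^ (2 * (d - 1))`, while `log n` is at most a
multiple of `L`. -/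

/-! ### Signed sums of well-separated vectors -/

/-- For an upper triangular system of affine forms whose diagonal entries are at least `δ` in
absolute value, integer points rarely make many of the forms smaller than `δ / 2`. -/
theorem sum_prod_small_le {q : ℕ} (k : ℕ) (δ : ℝ) (hδ : 0 < δ)
    (B : Fin k → Fin k → ℝ) (c : Fin k → ℝ) (htri : ∀ j i, i < j → B j i = 0)
    (hdiag : ∀ j, δ ≤ |B j j|) :
    ∑ x : Fin k → Fin q, ∏ j, (if |∑ i, B j i * ((x i : ℕ) : ℝ) + c j| < δ / 2 then q else 1)
      ≤ (2 * q) ^ k := by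
  induction k with
  | zero => simp
  | succ k ih =>
    rw [← (Fin.consEquiv fun _ : Fin (k + 1) => Fin q).sum_comp, Fintype.sum_prod_type_right]
    -- Only the form of index 0 involves the coordinate `t`. Its values at distinct integers `t`
    -- differ by at least `δ`, so at most one `t` costs `q`; the others together cost at most `q`.
    have key : ∀ y : Fin k → Fin q, ∑ t : Fin q,
        (if |B 0 0 * ((t : ℕ) : ℝ) + ∑ i : Fin k, B 0 i.succ * ((y i : ℕ) : ℝ) + c 0| < δ / 2
          then q else 1) ≤ 2 * q := by
      intro y
      set e := ∑ i : Fin k, B 0 i.succ * ((y i : ℕ) : ℝ) + c 0 with he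
      have hsub : (Finset.univ.filter fun t : Fin q =>
          |B 0 0 * ((t : ℕ) : ℝ) + ∑ i : Fin k, B 0 i.succ * ((y i : ℕ) : ℝ) + c 0|
            < δ / 2).card ≤ 1 := by
        rw [Finset.card_le_one]
        intro s hs t ht
        simp only [Finset.mem_filter, Finset.mem_univ, true_and, add_assoc] at hs ht
        by_contra hne
        have h1 : (1 : ℝ) ≤ |((s : ℕ) : ℝ) - ((t : ℕ) : ℝ)| := by
          have : ((s : ℕ) : ℤ) - ((t : ℕ) : ℤ) ≠ 0 := by
            intro h
            apply hne
            ext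
            omega
          have h2 := Int.one_le_abs this
          exact_mod_cast h2
        have h3 : |B 0 0 * ((s : ℕ) : ℝ) + e - (B 0 0 * ((t : ℕ) : ℝ) + e)| < δ :=
          (abs_sub _ _).trans_lt (by linarith)
        have h4 : B 0 0 * ((s : ℕ) : ℝ) + e - (B 0 0 * ((t : ℕ) : ℝ) + e)
            = B 0 0 * (((s : ℕ) : ℝ) - ((t : ℕ) : ℝ)) := by ring
        rw [h4, abs_mul] at h3
        nlinarith [hdiag 0]
      rw [Finset.sum_ite, Finset.sum_const, Finset.sum_const, smul_eq_mul, smul_eq_mul, mul_one]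
      have h5 := Finset.card_filter_le (Finset.univ : Finset (Fin q)) fun t : Fin q =>
        ¬ |B 0 0 * ((t : ℕ) : ℝ) + ∑ i : Fin k, B 0 i.succ * ((y i : ℕ) : ℝ) + c 0| < δ / 2
      rw [Finset.card_univ, Fintype.card_fin] at h5
      nlinarith
    calc _ = ∑ y : Fin k → Fin q, (∏ j : Fin k,
            (if |∑ i, B j.succ i.succ * ((y i : ℕ) : ℝ) + c j.succ| < δ / 2 then q else 1)) *
          ∑ t : Fin q, (if |B 0 0 * ((t : ℕ) : ℝ) +
            ∑ i : Fin k, B 0 i.succ * ((y i : ℕ) : ℝ) + c 0| < δ / 2 then q else 1) := by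
          refine Finset.sum_congr rfl fun y _ => ?_
          rw [Finset.mul_sum]
          refine Finset.sum_congr rfl fun t _ => ?_
          rw [Fin.prod_univ_succ, mul_comm]
          simp [Fin.sum_univ_succ, htri _ _ (Fin.succ_pos _)]
      _ ≤ ∑ y : Fin k → Fin q, (∏ j : Fin k,
            (if |∑ i, B j.succ i.succ * ((y i : ℕ) : ℝ) + c j.succ| < δ / 2 then q else 1)) *
            (2 * q) := Finset.sum_le_sum fun y _ => Nat.mul_le_mul_left _ (key y)
      _ ≤ (2 * q) ^ k * (2 * q) := by
          rw [← Finset.sum_mul]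
          exact Nat.mul_le_mul_right _ (ih _ _ (fun j i h => htri _ _ (Fin.succ_lt_succ_iff.2 h))
            fun j => hdiag _)
      _ = (2 * q) ^ (k + 1) := (pow_succ _ _).symm

/-- Bitwise rounding: if every subfamily has a signing with small sum, then every dyadic point of
the unit cube can be rounded to a vertex with a small change of the corresponding combination. -/
theorem exists_rounding {ι E : Type*} [Fintype ι] [SeminormedAddCommGroup E] [NormedSpace ℝ E]
    (v : ι → E) (Δ : ℝ)
    (h : ∀ S : Finset ι, ∃ χ : ι → ℤ, (∀ i, χ i = 1 ∨ χ i = -1) ∧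
      ‖∑ i ∈ S, (χ i : ℝ) • v i‖ ≤ Δ) (r : ℕ) (x : ι → ℤ) (hx : ∀ i, 0 ≤ x i ∧ x i ≤ 2 ^ r) :
    ∃ z : ι → Fin 2, ‖∑ i, ((x i : ℝ) - 2 ^ r * ((z i : ℕ) : ℝ)) • v i‖ ≤ (2 ^ r - 1) * Δ := by
  induction r generalizing x with
  | zero =>
    refine ⟨fun i => ⟨(x i).toNat, by have := hx i; simp at this; omega⟩, ?_⟩
    have : ∀ i, (((x i).toNat : ℕ) : ℝ) = x i := fun i => by
      exact_mod_cast Int.toNat_of_nonneg (hx i).1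
    simp [this]
  | succ r ih =>
    classical
    -- The odd coordinates are moved by `±1` to even values and everything is halved. An odd value
    -- lies strictly between the even bounds `0` and `2 ^ (r + 1)`, so the range is respected. The
    -- error obeys `e ↦ 2 * e + Δ`.
    obtain ⟨χ, hχ, hS⟩ := h (Finset.univ.filter fun i => x i % 2 = 1)
    have hy : ∀ i, ∃ y : ℤ, x i = 2 * y - (if x i % 2 = 1 then χ i else 0) ∧
        0 ≤ y ∧ y ≤ 2 ^ r := by
      intro i
      have h1 := hx i
      rw [pow_succ] at h1
      refine ⟨(x i + (if x i % 2 = 1 then χ i else 0)) / 2, ?_⟩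
      rcases hχ i with h2 | h2 <;> rw [h2] <;> split_ifs <;> omega
    choose y hxy hy0 using hy
    obtain ⟨z, hz⟩ := ih y hy0
    refine ⟨z, ?_⟩
    have hsum : ∑ i, ((x i : ℝ) - 2 ^ (r + 1) * ((z i : ℕ) : ℝ)) • v i =
        (2 : ℝ) • ∑ i, ((y i : ℝ) - 2 ^ r * ((z i : ℕ) : ℝ)) • v i -
          ∑ i ∈ Finset.univ.filter (fun i => x i % 2 = 1), (χ i : ℝ) • v i := by
      rw [Finset.smul_sum, Finset.sum_filter, ← Finset.sum_sub_distrib]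
      refine Finset.sum_congr rfl fun i _ => ?_
      have h3 : (x i : ℝ) = 2 * y i - (if x i % 2 = 1 then (χ i : ℝ) else 0) := by
        have := congrArg (Int.cast : ℤ → ℝ) (hxy i)
        push_cast at this
        exact this
      rw [smul_smul]
      split_ifs at h3 ⊢ with h4
      · rw [← sub_smul, h3]; congr 1; ring
      · rw [sub_zero, h3]; congr 1; ring
    rw [hsum]
    calc _ ≤ 2 * ‖∑ i, ((y i : ℝ) - 2 ^ r * ((z i : ℕ) : ℝ)) • v i‖ + Δ := by
          refine (norm_sub_le _ _).trans (add_le_add ?_ hS)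
          rw [norm_smul]; simp
      _ ≤ 2 * ((2 ^ r - 1) * Δ) + Δ := by gcongr
      _ = _ := by ring

open scoped InnerProductSpace in
/-- If `v` is triangular with respect to an orthonormal family, with diagonal entries at least `δ`,
then some subfamily has only large signed sums. -/
theorem exists_subset_signed_sum_large_of_triangular {E : Type*} [NormedAddCommGroup E]
    [InnerProductSpace ℝ E] {k : ℕ} (hk : 0 < k) (v e : Fin k → E) (he : Orthonormal ℝ e) (δ : ℝ)
    (hδ : 0 < δ) (htri : ∀ j i, i < j → ⟪e j, v i⟫_ℝ = 0) (hdiag : ∀ j, δ ≤ |⟪e j, v j⟫_ℝ|) :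
    ∃ S : Finset (Fin k), ∀ χ : Fin k → ℤ, (∀ i, χ i = 1 ∨ χ i = -1) →
      δ ^ 2 * k / 7688 ≤ ‖∑ i ∈ S, (χ i : ℝ) • v i‖ ^ 2 := by
  classical
  by_contra! hcon
  set Δ := Real.sqrt (δ ^ 2 * k / 7688) with hΔ
  have hΔ2 : Δ ^ 2 = δ ^ 2 * k / 7688 := Real.sq_sqrt (by positivity)
  -- Five bits give 32 values per coordinate and rounding error `31 * Δ`; `7688 = 8 * 31 ^ 2` makes
  -- its square `δ ^ 2 * k / 8`.
  have hround := exists_rounding v Δ (fun S => by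
    obtain ⟨χ, h1, h2⟩ := hcon S
    exact ⟨χ, h1, Real.le_sqrt_of_sq_le h2.le⟩) 5
  set B : Fin k → Fin k → ℝ := fun j i => ⟪e j, v i⟫_ℝ
  set form : (Fin k → Fin 2) → (Fin k → Fin 32) → Fin k → ℝ := fun z x j =>
    ∑ i, B j i * ((x i : ℕ) : ℝ) + (-∑ i, B j i * (32 * ((z i : ℕ) : ℝ))) with hform
  -- By Bessel, at most half of the forms can reach `δ / 2`; the remaining ones contribute at least
  -- `32 ^ (k / 2) ≥ 5 ^ k`.
  have hlow : ∀ x : Fin k → Fin 32, ∃ z : Fin k → Fin 2,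
      5 ^ k ≤ ∏ j, (if |form z x j| < δ / 2 then 32 else 1) := by
    intro x
    obtain ⟨z, hz⟩ := hround (fun i => ((x i : ℕ) : ℤ)) (fun i => by have := (x i).2; omega)
    refine ⟨z, ?_⟩
    set y := ∑ i, ((((x i : ℕ) : ℤ) : ℝ) - 2 ^ 5 * ((z i : ℕ) : ℝ)) • v i with hy
    have hco : ∀ j, ⟪e j, y⟫_ℝ = form z x j := by
      intro j
      rw [hy, inner_sum, hform]
      simp only [inner_smul_right]
      rw [← sub_eq_add_neg, ← Finset.sum_sub_distrib]
      refine Finset.sum_congr rfl fun i _ => ?_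
      simp only [B]
      push_cast
      ring
    have hb : ∑ j, form z x j ^ 2 ≤ δ ^ 2 * k / 8 := by
      have h1 := he.sum_inner_products_le y (s := Finset.univ)
      simp only [hco, Real.norm_eq_abs, sq_abs] at h1
      have h2 : ‖y‖ ^ 2 ≤ ((2 ^ 5 - 1) * Δ) ^ 2 := by gcongr
      rw [mul_pow, hΔ2] at h2
      nlinarith
    set far := Finset.univ.filter fun j => ¬ |form z x j| < δ / 2
    have hfar : (far.card : ℝ) * (δ ^ 2 / 4) ≤ δ ^ 2 * k / 8 := by
      refine le_trans ?_ hb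
      rw [← nsmul_eq_mul, ← Finset.sum_const]
      refine (Finset.sum_le_sum fun j hj => ?_).trans
        (Finset.sum_le_sum_of_subset_of_nonneg (Finset.subset_univ far) fun _ _ _ => sq_nonneg _)
      simp only [far, Finset.mem_filter, not_lt] at hj
      rw [← sq_abs (form z x j)]
      nlinarith
    have hfar2 : 2 * far.card ≤ k := by
      have : (2 * far.card : ℝ) ≤ k := by
        by_contra! h
        nlinarith [pow_pos hδ 2]
      exact_mod_cast this
    rw [Finset.prod_ite, Finset.prod_const, Finset.prod_const_one, mul_one]
    set close := Finset.univ.filter fun j => |form z x j| < δ / 2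
    have hcard : close.card + far.card = k := by
      have := Finset.card_filter_add_card_filter_not (s := Finset.univ)
        (fun j => |form z x j| < δ / 2)
      rwa [Finset.card_univ, Fintype.card_fin] at this
    refine (Nat.pow_le_pow_left (by norm_num : 5 ^ 2 ≤ 32) close.card).trans' ?_
    rw [← pow_mul]
    exact Nat.pow_le_pow_right (by norm_num) (by omega)
  -- Double counting over pairs `(x, z)` would give `160 ^ k ≤ 128 ^ k`.
  have h1 : 32 ^ k * 5 ^ k ≤ (2 ^ k * (2 * 32) ^ k : ℕ) := by
    calc 32 ^ k * 5 ^ k = ∑ x : Fin k → Fin 32, 5 ^ k := by simp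
      _ ≤ ∑ x : Fin k → Fin 32, ∑ z : Fin k → Fin 2,
          ∏ j, (if |form z x j| < δ / 2 then 32 else 1) := by
        refine Finset.sum_le_sum fun x _ => ?_
        obtain ⟨z, hz⟩ := hlow x
        exact hz.trans (Finset.single_le_sum
          (f := fun z => ∏ j, (if |form z x j| < δ / 2 then 32 else 1))
          (fun _ _ => Nat.zero_le _) (Finset.mem_univ z))
      _ = ∑ z : Fin k → Fin 2, ∑ x : Fin k → Fin 32,
          ∏ j, (if |form z x j| < δ / 2 then 32 else 1) := Finset.sum_comm
      _ ≤ ∑ z : Fin k → Fin 2, (2 * 32) ^ k :=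
        Finset.sum_le_sum fun z _ => sum_prod_small_le k δ hδ B _ htri hdiag
      _ = _ := by simp
  rw [← mul_pow, ← mul_pow] at h1
  exact absurd h1 (not_le.2 (Nat.pow_lt_pow_left (by norm_num) hk.ne'))

open scoped InnerProductSpace in
open InnerProductSpace in
/-- If each vector of a finite sequence has distance at least `δ` to the span of the previous
ones, then some subfamily has only large signed sums. -/
theorem exists_subset_signed_sum_large {E : Type*} [NormedAddCommGroup E]
    [InnerProductSpace ℝ E] {k : ℕ} (hk : 0 < k) (v : Fin k → E) (δ : ℝ) (hδ : 0 < δ)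
    (hdist : ∀ j, ∀ w ∈ Submodule.span ℝ (v '' Set.Iio j), δ ≤ ‖v j - w‖) :
    ∃ S : Finset (Fin k), ∀ χ : Fin k → ℤ, (∀ i, χ i = 1 ∨ χ i = -1) →
      δ ^ 2 * k / 7688 ≤ ‖∑ i ∈ S, (χ i : ℝ) • v i‖ ^ 2 := by
  set g := gramSchmidt ℝ v with hg
  have hnorm : ∀ j, δ ≤ ‖g j‖ := by
    intro j
    rw [hg, gramSchmidt_def]
    refine hdist j _ ?_
    rw [← span_gramSchmidt_Iio ℝ]
    refine Submodule.sum_mem _ fun i hi => ?_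
    rw [Submodule.starProjection_singleton]
    exact Submodule.smul_mem _ _ (Submodule.subset_span ⟨i, Finset.mem_Iio.1 hi, rfl⟩)
  have hpos : ∀ j, 0 < ‖g j‖ := fun j => hδ.trans_le (hnorm j)
  refine exists_subset_signed_sum_large_of_triangular hk v (fun j => ‖g j‖⁻¹ • g j)
    ⟨fun j => ?_, fun i j hij => ?_⟩ δ hδ (fun j i hij => ?_) fun j => ?_
  · rw [norm_smul, norm_inv, norm_norm, inv_mul_cancel₀ (hpos j).ne']
  · change ⟪‖g i‖⁻¹ • g i, ‖g j‖⁻¹ • g j⟫_ℝ = 0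
    rw [real_inner_smul_left, real_inner_smul_right, gramSchmidt_orthogonal ℝ v hij]
    simp
  · rw [real_inner_smul_left, gramSchmidt_inv_triangular ℝ v hij, mul_zero]
  · have h1 : ⟪g j, v j⟫_ℝ = ‖g j‖ ^ 2 := by
      rw [gramSchmidt_def'' ℝ v j, inner_add_right, inner_sum, Finset.sum_eq_zero, add_zero,
        real_inner_self_eq_norm_sq]
      intro i hi
      rw [inner_smul_right, gramSchmidt_orthogonal ℝ v (Finset.mem_Iio.1 hi).ne', mul_zero]
    rw [real_inner_smul_left, h1, sq, inv_mul_cancel_left₀ (hpos j).ne', abs_norm]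
    exact hnorm j

/-! ### Choosing vectors far from the span of their predecessors -/

/-- Greedy selection of vectors that stay far from the span of their predecessors. -/
theorem exists_greedy_sequence {Ω E : Type*} [NormedAddCommGroup E] [NormedSpace ℝ E]
    (C : Ω → E) (k : ℕ) (δ : ℝ)
    (hstep : ∀ W : Submodule ℝ E, Module.finrank ℝ W < k → ∃ p, ∀ w ∈ W, δ ≤ ‖C p - w‖) :
    ∃ p : Fin k → Ω, ∀ j, ∀ w ∈ Submodule.span ℝ ((C ∘ p) '' Set.Iio j), δ ≤ ‖C (p j) - w‖ := by
  classical
  rcases Nat.eq_zero_or_pos k with rfl | hk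
  · exact ⟨fun j => j.elim0, fun j => j.elim0⟩
  have : Nonempty Ω := ⟨(hstep ⊥ (by simpa using hk)).choose⟩
  have hS : ∀ S : Finset Ω, ∃ p, S.card < k →
      ∀ w ∈ Submodule.span ℝ (C '' S), δ ≤ ‖C p - w‖ := by
    intro S
    by_cases h : S.card < k
    · obtain ⟨p, hp⟩ := hstep (Submodule.span ℝ (C '' S)) (by
        rw [← Finset.coe_image]
        exact (finrank_span_finset_le_card _).trans_lt (Finset.card_image_le.trans_lt h))
      exact ⟨p, fun _ => hp⟩
    · exact ⟨Classical.arbitrary Ω, fun h' => absurd h' h⟩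
  choose step hstep' using hS
  let A : ℕ → Finset Ω := fun n => Nat.rec ∅ (fun _ S => insert (step S) S) n
  have hA : ∀ n, A (n + 1) = insert (step (A n)) (A n) := fun n => rfl
  have hmono : Monotone A := monotone_nat_of_le_succ fun n => by
    rw [hA]; exact Finset.subset_insert _ _
  have hcard : ∀ n, (A n).card ≤ n := by
    intro n
    induction n with
    | zero => simp [A]
    | succ n ih => rw [hA]; exact (Finset.card_insert_le _ _).trans (by omega)
  refine ⟨fun j => step (A j), fun j w hw => hstep' (A j) ((hcard j).trans_lt j.2) w ?_⟩
  refine Submodule.span_mono ?_ hw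
  rintro _ ⟨i, hi, rfl⟩
  refine ⟨step (A i), ?_, rfl⟩
  have : A (i + 1) ≤ A j := hmono (Nat.succ_le_of_lt hi)
  exact this (by rw [hA]; exact Finset.mem_insert_self _ _)

open scoped InnerProductSpace in
/-- If the map `u ↦ (⟪u, C p⟫)_p` is bounded below by `s` on a subspace of dimension at least `2k`,
then every subspace of dimension less than `k` is far from some `C p`. -/
theorem exists_far_from_subspace {Ω E : Type*} [Fintype Ω] [NormedAddCommGroup E]
    [InnerProductSpace ℝ E] [FiniteDimensional ℝ E] (C : Ω → E) (G : Submodule ℝ E)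
    (s : ℝ) (hG : ∀ u ∈ G, s * ‖u‖ ^ 2 ≤ ∑ p, ⟪u, C p⟫_ℝ ^ 2) (hs : 0 < s) (k : ℕ)
    (hk : 2 * k ≤ Module.finrank ℝ G) (W : Submodule ℝ E) (hW : Module.finrank ℝ W < k) :
    ∃ p, ∀ w ∈ W, s * k / Fintype.card Ω ≤ ‖C p - w‖ ^ 2 := by
  -- Vectors of `W` are invisible to `U`, so the projection of `C p` to `U` bounds its distance to
  -- `W`. Since `U` has dimension at least `2 * k - k`, the squared projections sum to at least `s *
  -- k` over `p`, and some `p` reaches the average.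
  set U := G ⊓ Wᗮ with hU
  have hdim : k ≤ Module.finrank ℝ U := by
    have h1 := Submodule.finrank_sup_add_finrank_inf_eq G Wᗮ
    have h2 := Submodule.finrank_add_finrank_orthogonal W
    have h3 := Submodule.finrank_le (G ⊔ Wᗮ)
    rw [← hU] at h1
    omega
  set b := stdOrthonormalBasis ℝ U
  have hon : Orthonormal ℝ (fun i => (b i : E)) := b.orthonormal.comp_linearIsometry U.subtypeₗᵢ
  have hsum : s * k ≤ ∑ p, ∑ i, ⟪(b i : E), C p⟫_ℝ ^ 2 := by
    rw [Finset.sum_comm]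
    calc s * k ≤ s * Module.finrank ℝ U := by gcongr
      _ = ∑ i : Fin (Module.finrank ℝ U), s * ‖(b i : E)‖ ^ 2 := by
        simp [hon.1, mul_comm]
      _ ≤ _ := Finset.sum_le_sum fun i _ => hG _ (b i).2.1
  have hne : Nonempty Ω := by
    by_contra h
    rw [not_nonempty_iff] at h
    simp only [Finset.univ_eq_empty, Finset.sum_empty] at hsum
    have : (0 : ℝ) < k := by exact_mod_cast (Nat.zero_le _).trans_lt hW
    nlinarith [mul_pos hs this]
  obtain ⟨p, -, hp⟩ := Finset.exists_le_of_sum_le (s := Finset.univ)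
    (f := fun _ : Ω => s * k / Fintype.card Ω) (g := fun p => ∑ i, ⟪(b i : E), C p⟫_ℝ ^ 2)
    Finset.univ_nonempty (by
      simp only [Finset.sum_const, Finset.card_univ, nsmul_eq_mul]
      rw [mul_div_cancel₀ _ (by exact_mod_cast Fintype.card_ne_zero)]
      exact hsum)
  refine ⟨p, fun w hw => hp.trans ?_⟩
  have h1 := hon.sum_inner_products_le (C p - w) (s := Finset.univ)
  refine le_trans (le_of_eq ?_) h1
  refine Finset.sum_congr rfl fun i _ => ?_
  have h2 : ⟪(b i : E), w⟫_ℝ = 0 := by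
    rw [real_inner_comm]
    exact (Submodule.mem_orthogonal W _).1 (b i).2.2 w hw
  rw [inner_sub_right, h2, sub_zero, Real.norm_eq_abs, sq_abs]

/-! ### One-dimensional Haar, bump and tent functions -/

/-- The step function with values `1, 1, -1, -1` on the consecutive quarters of length `l` of the
block `[4 l i, 4 l (i + 1))`. -/
def haarStep (l i t : ℕ) : ℤ :=
  if t < 4 * l * i then 0 else if t < 4 * l * i + 2 * l then 1
  else if t < 4 * l * i + 4 * l then -1 else 0

/-- The step function with values `-1, 1, 1, -1` on the consecutive quarters of length `l` of the
block `[4 l i, 4 l (i + 1))`. -/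
def bumpStep (l i t : ℕ) : ℤ :=
  if t < 4 * l * i then 0 else if t < 4 * l * i + l then -1
  else if t < 4 * l * i + 3 * l then 1
  else if t < 4 * l * i + 4 * l then -1 else 0

/-- The prefix sums of `haarStep l i`. -/
def tent (l i t : ℕ) : ℤ :=
  if t < 4 * l * i then 0 else if t < 4 * l * i + 2 * l then (t : ℤ) + 1 - (4 * l * i : ℕ)
  else if t < 4 * l * i + 4 * l then (4 * l * i : ℕ) + 4 * (l : ℤ) - 1 - t else 0

theorem sum_range_haarStep (l i t : ℕ) :
    ∑ p ∈ Finset.range (t + 1), haarStep l i p = tent l i t := by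
  induction t with
  | zero =>
    rw [zero_add, Finset.sum_range_one]
    unfold haarStep tent
    generalize 4 * l * i = A
    split_ifs <;> push_cast <;> omega
  | succ t ih =>
    rw [Finset.sum_range_succ, ih]
    unfold haarStep tent
    generalize 4 * l * i = A
    split_ifs <;> push_cast <;> omega

theorem sum_range_eq_sum_quarters {M : Type*} [AddCommMonoid M] (φ : ℕ → M) (A l m : ℕ)
    (hm : A + 4 * l ≤ m) (h : ∀ t, t < A ∨ A + 4 * l ≤ t → φ t = 0) :
    ∑ t ∈ Finset.range m, φ t =
      ∑ r ∈ Finset.range l, (φ (A + r) + φ (A + l + r) + φ (A + 2 * l + r) + φ (A + 3 * l + r)) := by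
  obtain ⟨n, rfl⟩ := Nat.exists_eq_add_of_le hm
  have e : A + 4 * l + n = A + (l + (l + (l + (l + n)))) := by ring
  rw [e]
  simp only [Finset.sum_range_add, Finset.sum_add_distrib]
  rw [Finset.sum_eq_zero (s := Finset.range A), Finset.sum_eq_zero (s := Finset.range n)]
  · simp only [zero_add, add_zero, add_assoc, two_mul, (by omega : 3 * l = l + (l + l))]
  · exact fun t _ => h _ (Or.inr (by omega))
  · exact fun t ht => h _ (Or.inl (Finset.mem_range.1 ht))

theorem haarStep_of_outside {l i t : ℕ} (h : t < 4 * l * i ∨ 4 * l * i + 4 * l ≤ t) :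
    haarStep l i t = 0 := by
  unfold haarStep; split_ifs <;> first | rfl | omega

theorem bumpStep_of_outside {l i t : ℕ} (h : t < 4 * l * i ∨ 4 * l * i + 4 * l ≤ t) :
    bumpStep l i t = 0 := by
  unfold bumpStep; split_ifs <;> first | rfl | omega

theorem tent_of_outside {l i t : ℕ} (h : t < 4 * l * i ∨ 4 * l * i + 4 * l ≤ t) :
    tent l i t = 0 := by
  unfold tent; split_ifs <;> first | rfl | omega

theorem sum_haarStep_mul (l i m : ℕ) (hm : 4 * l * i + 4 * l ≤ m) (y : ℕ → ℤ) :
    ∑ t ∈ Finset.range m, haarStep l i t * y t = ∑ r ∈ Finset.range l,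
      (y (4 * l * i + r) + y (4 * l * i + l + r) - y (4 * l * i + 2 * l + r)
        - y (4 * l * i + 3 * l + r)) := by
  rw [sum_range_eq_sum_quarters _ (4 * l * i) l m hm
    fun t ht => by rw [haarStep_of_outside ht, zero_mul]]
  refine Finset.sum_congr rfl fun r hr => ?_
  have hr := Finset.mem_range.1 hr
  unfold haarStep
  generalize 4 * l * i = A
  rw [if_neg (by omega), if_pos (by omega), if_neg (by omega), if_pos (by omega),
    if_neg (by omega), if_neg (by omega), if_pos (by omega),
    if_neg (by omega), if_neg (by omega), if_pos (by omega)]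
  ring

theorem sum_bumpStep_mul (l i m : ℕ) (hm : 4 * l * i + 4 * l ≤ m) (y : ℕ → ℤ) :
    ∑ t ∈ Finset.range m, bumpStep l i t * y t = ∑ r ∈ Finset.range l,
      (-y (4 * l * i + r) + y (4 * l * i + l + r) + y (4 * l * i + 2 * l + r)
        - y (4 * l * i + 3 * l + r)) := by
  rw [sum_range_eq_sum_quarters _ (4 * l * i) l m hm
    fun t ht => by rw [bumpStep_of_outside ht, zero_mul]]
  refine Finset.sum_congr rfl fun r hr => ?_
  have hr := Finset.mem_range.1 hr
  unfold bumpStep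
  generalize 4 * l * i = A
  rw [if_neg (by omega), if_pos (by omega), if_neg (by omega), if_neg (by omega),
    if_pos (by omega), if_neg (by omega), if_neg (by omega), if_pos (by omega),
    if_neg (by omega), if_neg (by omega), if_neg (by omega), if_pos (by omega)]
  ring

theorem sum_haarStep_mul_eq_zero_of_const {l i m : ℕ} (hm : 4 * l * i + 4 * l ≤ m) {y : ℕ → ℤ}
    {α : ℤ} (hy : ∀ r < 4 * l, y (4 * l * i + r) = α) :
    ∑ t ∈ Finset.range m, haarStep l i t * y t = 0 := by
  rw [sum_haarStep_mul l i m hm]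
  refine Finset.sum_eq_zero fun r hr => ?_
  have hr := Finset.mem_range.1 hr
  simp only [add_assoc]
  rw [hy _ (by omega), hy _ (by omega), hy _ (by omega), hy _ (by omega)]
  ring

/-- The sign pattern `-, +, +, -` kills constants and also linear functions, because `-0 + 1 + 2 - 3
= 0`. This is why bumps, not Haar functions, are tested against tents. -/
theorem sum_bumpStep_mul_eq_zero_of_affine {l i m : ℕ} (hm : 4 * l * i + 4 * l ≤ m) {y : ℕ → ℤ}
    {α β : ℤ} (hy : ∀ r < 4 * l, y (4 * l * i + r) = α + β * r) :
    ∑ t ∈ Finset.range m, bumpStep l i t * y t = 0 := by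
  rw [sum_bumpStep_mul l i m hm]
  refine Finset.sum_eq_zero fun r hr => ?_
  have hr := Finset.mem_range.1 hr
  simp only [add_assoc]
  rw [hy _ (by omega), hy _ (by omega), hy _ (by omega), hy _ (by omega)]
  push_cast
  ring

theorem mul_add_lt_mul_iff {M i r K : ℕ} (hr : r < M) : M * i + r < M * K ↔ i < K := by
  constructor
  · intro h
    by_contra! hc
    have := Nat.mul_le_mul_left M hc
    omega
  · intro h
    have := Nat.mul_le_mul_left M (Nat.succ_le_of_lt h)
    rw [Nat.mul_succ] at this
    omega

/-- All breakpoints of the coarser function are multiples of the finer block length `4 * l`, so none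
falls inside a block. The next two lemmas rest on the same fact. -/
theorem exists_haarStep_const_on_block (l i c i' : ℕ) :
    ∃ α, ∀ r < 4 * l, haarStep (4 * l * c) i' (4 * l * i + r) = α := by
  refine ⟨if i < 4 * c * i' then 0 else if i < 4 * c * i' + 2 * c then 1
    else if i < 4 * c * i' + 4 * c then -1 else 0, fun r hr => ?_⟩
  unfold haarStep
  rw [show 4 * (4 * l * c) * i' + 4 * (4 * l * c) = 4 * l * (4 * c * i' + 4 * c) by ring,
    show 4 * (4 * l * c) * i' + 2 * (4 * l * c) = 4 * l * (4 * c * i' + 2 * c) by ring,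
    show 4 * (4 * l * c) * i' = 4 * l * (4 * c * i') by ring]
  simp only [mul_add_lt_mul_iff hr]

theorem exists_bumpStep_const_on_block (l i c i' : ℕ) :
    ∃ α, ∀ r < 4 * l, bumpStep (4 * l * c) i' (4 * l * i + r) = α := by
  refine ⟨if i < 4 * c * i' then 0 else if i < 4 * c * i' + c then -1
    else if i < 4 * c * i' + 3 * c then 1
    else if i < 4 * c * i' + 4 * c then -1 else 0, fun r hr => ?_⟩
  unfold bumpStep
  rw [show 4 * (4 * l * c) * i' + 4 * (4 * l * c) = 4 * l * (4 * c * i' + 4 * c) by ring,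
    show 4 * (4 * l * c) * i' + 3 * (4 * l * c) = 4 * l * (4 * c * i' + 3 * c) by ring,
    show 4 * (4 * l * c) * i' + 4 * l * c = 4 * l * (4 * c * i' + c) by ring,
    show 4 * (4 * l * c) * i' = 4 * l * (4 * c * i') by ring]
  simp only [mul_add_lt_mul_iff hr]

theorem exists_tent_affine_on_block (l i c i' : ℕ) :
    ∃ α β, ∀ r < 4 * l, tent (4 * l * c) i' (4 * l * i + r) = α + β * (r : ℤ) := by
  have h : ∀ r < 4 * l, tent (4 * l * c) i' (4 * l * i + r) =
      if i < 4 * c * i' then 0 else if i < 4 * c * i' + 2 * c then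
        ((4 * l * i + r : ℕ) : ℤ) + 1 - (4 * (4 * l * c) * i' : ℕ)
      else if i < 4 * c * i' + 4 * c then (4 * (4 * l * c) * i' : ℕ) +
        4 * ((4 * l * c : ℕ) : ℤ) - 1 - (4 * l * i + r : ℕ) else 0 := by
    intro r hr
    unfold tent
    rw [show 4 * (4 * l * c) * i' + 4 * (4 * l * c) = 4 * l * (4 * c * i' + 4 * c) by ring,
      show 4 * (4 * l * c) * i' + 2 * (4 * l * c) = 4 * l * (4 * c * i' + 2 * c) by ring,
      show 4 * (4 * l * c) * i' = 4 * l * (4 * c * i') by ring]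
    simp only [mul_add_lt_mul_iff hr]
  by_cases h1 : i < 4 * c * i'
  · exact ⟨0, 0, fun r hr => by rw [h r hr, if_pos h1]; ring⟩
  by_cases h2 : i < 4 * c * i' + 2 * c
  · refine ⟨4 * l * i + 1 - (4 * (4 * l * c) * i' : ℕ), 1, fun r hr => ?_⟩
    rw [h r hr, if_neg h1, if_pos h2]
    push_cast
    ring
  by_cases h3 : i < 4 * c * i' + 4 * c
  · refine ⟨(4 * (4 * l * c) * i' : ℕ) + 4 * ((4 * l * c : ℕ) : ℤ) - 1 - 4 * l * i, -1,
      fun r hr => ?_⟩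
    rw [h r hr, if_neg h1, if_neg h2, if_pos h3]
    push_cast
    ring
  · exact ⟨0, 0, fun r hr => by rw [h r hr, if_neg h1, if_neg h2, if_neg h3]; ring⟩

theorem block_outside {l i i' r : ℕ} (hi : i ≠ i') (hr : r < 4 * l) :
    4 * l * i + r < 4 * l * i' ∨ 4 * l * i' + 4 * l ≤ 4 * l * i + r := by
  rcases lt_or_gt_of_ne hi with h | h
  · exact Or.inl ((mul_add_lt_mul_iff hr).2 h)
  · right
    have := Nat.mul_le_mul_left (4 * l) (Nat.succ_le_of_lt h)
    rw [Nat.mul_succ] at this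
    omega

/-! ### Orthogonality across 4-adic scales -/

/-- The quarter length of the blocks of relative size `4 ^ (-a)` in `[0, 4 ^ (L + 1))`. -/
def quarter (L a : ℕ) : ℕ := 4 ^ (L - a)

theorem block_end_le {L a i : ℕ} (ha : a ≤ L) (hi : i < 4 ^ a) :
    4 * quarter L a * i + 4 * quarter L a ≤ 4 ^ (L + 1) := by
  have h1 : 4 * quarter L a * 4 ^ a = 4 ^ (L + 1) := by
    rw [quarter, mul_assoc, ← pow_add, Nat.sub_add_cancel ha, pow_succ, mul_comm]
  rw [← h1, ← Nat.mul_succ]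
  exact Nat.mul_le_mul_left _ hi

/-- Here the ratio 4 between scales matters: already at adjacent scales a coarse quarter is a union
of whole fine blocks, which a ratio of 2 would not ensure. -/
theorem exists_quarter_eq {L a a' : ℕ} (h : a' < a) (ha : a ≤ L) :
    ∃ c, quarter L a' = 4 * quarter L a * c := by
  refine ⟨4 ^ (a - a' - 1), ?_⟩
  rw [quarter, quarter, mul_assoc, ← pow_add, ← pow_succ']
  congr 1
  omega

theorem sum_haarStep_mul_haarStep_eq_zero {L a a' i i' : ℕ} (ha : a ≤ L) (ha' : a' ≤ L)
    (hi : i < 4 ^ a) (hi' : i' < 4 ^ a') (h : a ≠ a' ∨ i ≠ i') :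
    ∑ t ∈ Finset.range (4 ^ (L + 1)),
      haarStep (quarter L a) i t * haarStep (quarter L a') i' t = 0 := by
  wlog hle : a' ≤ a generalizing a a' i i'
  · simp_rw [mul_comm (haarStep (quarter L a) i _)]
    exact this ha' ha hi' hi (h.imp Ne.symm Ne.symm) (by omega)
  rcases hle.lt_or_eq with hlt | rfl
  · obtain ⟨c, hc⟩ := exists_quarter_eq hlt ha
    obtain ⟨α, hα⟩ := exists_haarStep_const_on_block (quarter L a) i c i'
    rw [hc]
    exact sum_haarStep_mul_eq_zero_of_const (block_end_le ha hi) hα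
  · have hne : i ≠ i' := h.resolve_left (fun h => h rfl)
    exact sum_haarStep_mul_eq_zero_of_const (block_end_le ha hi) (α := 0)
      fun r hr => haarStep_of_outside (block_outside hne hr)

theorem sum_bumpStep_mul_bumpStep_eq_zero {L a a' i i' : ℕ} (ha : a ≤ L) (ha' : a' ≤ L)
    (hi : i < 4 ^ a) (hi' : i' < 4 ^ a') (h : a ≠ a' ∨ i ≠ i') :
    ∑ t ∈ Finset.range (4 ^ (L + 1)),
      bumpStep (quarter L a) i t * bumpStep (quarter L a') i' t = 0 := by
  wlog hle : a' ≤ a generalizing a a' i i'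
  · simp_rw [mul_comm (bumpStep (quarter L a) i _)]
    exact this ha' ha hi' hi (h.imp Ne.symm Ne.symm) (by omega)
  rcases hle.lt_or_eq with hlt | rfl
  · obtain ⟨c, hc⟩ := exists_quarter_eq hlt ha
    obtain ⟨α, hα⟩ := exists_bumpStep_const_on_block (quarter L a) i c i'
    rw [hc]
    exact sum_bumpStep_mul_eq_zero_of_affine (block_end_le ha hi) (α := α) (β := 0)
      fun r hr => by rw [hα r hr]; ring
  · have hne : i ≠ i' := h.resolve_left (fun h => h rfl)
    exact sum_bumpStep_mul_eq_zero_of_affine (block_end_le ha hi) (α := 0) (β := 0)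
      fun r hr => by rw [bumpStep_of_outside (block_outside hne hr)]; ring

/-- Unlike the two orthogonality relations above, this one is one-sided: the tent must be coarser
than the bump, or sit on another block of the same scale. -/
theorem sum_bumpStep_mul_tent_eq_zero {L a a' i i' : ℕ} (ha : a ≤ L)
    (hi : i < 4 ^ a) (h : a' < a ∨ a = a' ∧ i ≠ i') :
    ∑ t ∈ Finset.range (4 ^ (L + 1)),
      bumpStep (quarter L a) i t * tent (quarter L a') i' t = 0 := by
  rcases h with hlt | ⟨rfl, hne⟩
  · obtain ⟨c, hc⟩ := exists_quarter_eq hlt ha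
    obtain ⟨α, β, hα⟩ := exists_tent_affine_on_block (quarter L a) i c i'
    rw [hc]
    exact sum_bumpStep_mul_eq_zero_of_affine (block_end_le ha hi) hα
  · exact sum_bumpStep_mul_eq_zero_of_affine (block_end_le ha hi) (α := 0) (β := 0)
      fun r hr => by rw [tent_of_outside (block_outside hne hr)]; ring

theorem sum_haarStep_mul_self {l i m : ℕ} (hm : 4 * l * i + 4 * l ≤ m) :
    ∑ t ∈ Finset.range m, haarStep l i t * haarStep l i t = 4 * l := by
  rw [sum_haarStep_mul l i m hm]
  trans ∑ r ∈ Finset.range l, (4 : ℤ)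
  · refine Finset.sum_congr rfl fun r hr => ?_
    have hr := Finset.mem_range.1 hr
    unfold haarStep
    generalize 4 * l * i = A
    rw [if_neg (by omega), if_pos (by omega), if_neg (by omega), if_pos (by omega),
      if_neg (by omega), if_neg (by omega), if_pos (by omega),
      if_neg (by omega), if_neg (by omega), if_pos (by omega)]
    norm_num
  · simp [mul_comm]

theorem sum_bumpStep_mul_self {l i m : ℕ} (hm : 4 * l * i + 4 * l ≤ m) :
    ∑ t ∈ Finset.range m, bumpStep l i t * bumpStep l i t = 4 * l := by
  rw [sum_bumpStep_mul l i m hm]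
  trans ∑ r ∈ Finset.range l, (4 : ℤ)
  · refine Finset.sum_congr rfl fun r hr => ?_
    have hr := Finset.mem_range.1 hr
    unfold bumpStep
    generalize 4 * l * i = A
    rw [if_neg (by omega), if_pos (by omega), if_neg (by omega), if_neg (by omega),
      if_pos (by omega), if_neg (by omega), if_neg (by omega), if_pos (by omega),
      if_neg (by omega), if_neg (by omega), if_neg (by omega), if_pos (by omega)]
    norm_num
  · simp [mul_comm]

theorem sum_bumpStep_mul_tent_self {l i m : ℕ} (hm : 4 * l * i + 4 * l ≤ m) :
    ∑ t ∈ Finset.range m, bumpStep l i t * tent l i t = 2 * l ^ 2 := by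
  rw [sum_bumpStep_mul l i m hm]
  trans ∑ r ∈ Finset.range l, (2 * l : ℤ)
  · refine Finset.sum_congr rfl fun r hr => ?_
    have hr := Finset.mem_range.1 hr
    unfold tent
    generalize 4 * l * i = A
    rw [if_neg (by omega), if_pos (by omega), if_neg (by omega), if_pos (by omega),
      if_neg (by omega), if_neg (by omega), if_pos (by omega),
      if_neg (by omega), if_neg (by omega), if_pos (by omega)]
    push_cast
    ring
  · simp
    ring

/-! ### Tensor products and the dominance form -/

open scoped InnerProductSpace in
/-- If the orthonormal families `g` and `f` diagonalize the bilinear form of the vectors `C p` with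
all diagonal entries `σ`, then `u ↦ (⟪u, C p⟫)_p` is bounded below by `σ` on the span of `g`. -/
theorem sq_mul_norm_sq_le_sum_inner_sq {H Ω E : Type*} [Fintype H] [DecidableEq H] [Fintype Ω]
    [NormedAddCommGroup E] [InnerProductSpace ℝ E] (C : Ω → E) (g : H → E) (hg : Orthonormal ℝ g)
    (f : H → EuclideanSpace ℝ Ω) (hf : Orthonormal ℝ f) (σ : ℝ)
    (hpair : ∀ R R', ∑ p, f R' p * ⟪g R, C p⟫_ℝ = if R = R' then σ else 0) (u : E)
    (hu : u ∈ Submodule.span ℝ (Set.range g)) : σ ^ 2 * ‖u‖ ^ 2 ≤ ∑ p, ⟪u, C p⟫_ℝ ^ 2 := by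
  obtain ⟨c, rfl⟩ := (Submodule.mem_span_range_iff_exists_fun ℝ).1 hu
  set u := ∑ R, c R • g R with hudef
  have hnorm : ‖u‖ ^ 2 = ∑ R, c R ^ 2 := by
    rw [← real_inner_self_eq_norm_sq, hudef, hg.inner_sum]
    simp [sq]
  set y : EuclideanSpace ℝ Ω := WithLp.toLp 2 fun p => ⟪u, C p⟫_ℝ with hy
  have hco : ∀ R, ⟪f R, y⟫_ℝ = σ * c R := by
    intro R
    calc ⟪f R, y⟫_ℝ = ∑ p, f R p * ∑ R', c R' * ⟪g R', C p⟫_ℝ := by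
          simp only [hy, PiLp.inner_apply, hudef, sum_inner, real_inner_smul_left]
          exact Finset.sum_congr rfl fun p _ => mul_comm _ _
      _ = ∑ R', c R' * ∑ p, f R p * ⟪g R', C p⟫_ℝ := by
          simp_rw [Finset.mul_sum]
          rw [Finset.sum_comm]
          exact Finset.sum_congr rfl fun _ _ => Finset.sum_congr rfl fun _ _ => by ring
      _ = σ * c R := by simp only [hpair]; simp [mul_comm]
  have h1 := hf.sum_inner_products_le y (s := Finset.univ)
  simp only [hco, Real.norm_eq_abs, sq_abs, mul_pow] at h1
  rw [← Finset.mul_sum, ← hnorm, EuclideanSpace.norm_sq_eq] at h1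
  simpa [hy] using h1

/-- The tensor product of functions of one variable. -/
noncomputable def tensor {d m : ℕ} (u : Fin d → Fin m → ℝ) : EuclideanSpace ℝ (Fin d → Fin m) :=
  WithLp.toLp 2 fun p => ∏ k, u k (p k)

open scoped InnerProductSpace in
theorem inner_tensor {d m : ℕ} (u w : Fin d → Fin m → ℝ) :
    ⟪tensor u, tensor w⟫_ℝ = ∏ k, ∑ t, u k t * w k t := by
  rw [Finset.prod_univ_sum, Fintype.piFinset_univ, PiLp.inner_apply]
  refine Finset.sum_congr rfl fun p _ => ?_
  rw [Finset.prod_mul_distrib, mul_comm]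
  rfl

open Classical in
/-- The indicator function of the grid points dominating `p`. -/
noncomputable def dominating {d m : ℕ} (p : Fin d → Fin m) : EuclideanSpace ℝ (Fin d → Fin m) :=
  WithLp.toLp 2 fun x => if p ≤ x then 1 else 0

theorem dominating_eq_tensor {d m : ℕ} (p : Fin d → Fin m) :
    dominating p = tensor fun k t => if p k ≤ t then 1 else 0 := by
  ext x
  simp only [dominating, tensor, Pi.le_def]
  rw [Finset.prod_ite_zero]
  simp

open scoped InnerProductSpace in
-- The dominance relation is a product over coordinates, so the form factors into one-dimensional
-- pairings of `u k` with the prefix sums of `w k`; for Haar steps these prefix sums are tents.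
theorem sum_tensor_mul_inner_dominating {d m : ℕ} (u w : Fin d → Fin m → ℝ) :
    ∑ p, tensor w p * ⟪tensor u, dominating p⟫_ℝ =
      ∏ k, ∑ t, u k t * ∑ s, if s ≤ t then w k s else 0 := by
  simp_rw [dominating_eq_tensor, inner_tensor]
  trans ∏ k, ∑ s, w k s * ∑ t, u k t * if s ≤ t then 1 else 0
  · rw [Finset.prod_univ_sum, Fintype.piFinset_univ]
    refine Finset.sum_congr rfl fun p _ => ?_
    rw [Finset.prod_mul_distrib]
    rfl
  · refine Finset.prod_congr rfl fun k _ => ?_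
    simp_rw [Finset.mul_sum]
    rw [Finset.sum_comm]
    refine Finset.sum_congr rfl fun t _ => Finset.sum_congr rfl fun s _ => ?_
    split_ifs <;> ring

/-! ### Boxes of equal volume and their orthonormal families -/

/-- Boxes of relative volume `4 ^ (-L)` whose `k`-th side is a `4`-adic interval of relative length
`4 ^ (-a k)`. -/
abbrev BoxIndex (d L : ℕ) : Type :=
  Σ a : (Finset.univ : Finset (Fin d)).finsuppAntidiag L, ∀ k, Fin (4 ^ (a : Fin d →₀ ℕ) k)

namespace BoxIndex

variable {d L : ℕ}

/-- The scale exponents of a box. -/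
def scale (R : BoxIndex d L) (k : Fin d) : ℕ := (R.1 : Fin d →₀ ℕ) k

/-- The position of a box. -/
def pos (R : BoxIndex d L) (k : Fin d) : ℕ := R.2 k

theorem sum_scale (R : BoxIndex d L) : ∑ k, R.scale k = L :=
  (Finset.mem_finsuppAntidiag.1 R.1.2).1

theorem scale_le (R : BoxIndex d L) (k : Fin d) : R.scale k ≤ L := by
  conv_rhs => rw [← R.sum_scale]
  exact Finset.single_le_sum (f := R.scale) (fun _ _ => Nat.zero_le _) (Finset.mem_univ k)

theorem pos_lt (R : BoxIndex d L) (k : Fin d) : R.pos k < 4 ^ R.scale k := (R.2 k).2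

/-- Equal volume is essential: the scales of both boxes sum to `L`, so if `R'` is nowhere coarser
than `R`, all scales agree and only positions can differ. This supplies the coordinate in which the
one-sided bump–tent relation applies. -/
theorem exists_ne_of_ne {R R' : BoxIndex d L} (h : R ≠ R') :
    ∃ k, R'.scale k < R.scale k ∨ R.scale k = R'.scale k ∧ R.pos k ≠ R'.pos k := by
  by_contra! hcon
  apply h
  have hle : ∀ k, R.scale k ≤ R'.scale k := fun k => (hcon k).1
  have heq : ∀ k, R.scale k = R'.scale k := by
    have := (Finset.sum_eq_sum_iff_of_le fun k _ => hle k).1 (R.sum_scale.trans R'.sum_scale.symm)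
    exact fun k => this k (Finset.mem_univ k)
  have hpos : ∀ k, R.pos k = R'.pos k := fun k => (hcon k).2 (heq k)
  obtain ⟨a, i⟩ := R
  obtain ⟨a', i'⟩ := R'
  obtain rfl : a = a' := Subtype.ext (Finsupp.ext heq)
  congr
  exact funext fun k => Fin.ext (hpos k)

theorem card_eq : Fintype.card (BoxIndex d L) = (d + L - 1).choose L * 4 ^ L := by
  rw [Fintype.card_sigma]
  trans ∑ a : (Finset.univ : Finset (Fin d)).finsuppAntidiag L, 4 ^ L
  · refine Finset.sum_congr rfl fun a _ => ?_
    simp only [Fintype.card_pi, Fintype.card_fin]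
    rw [Finset.prod_pow_eq_pow_sum, (Finset.mem_finsuppAntidiag.1 a.2).1]
  · rw [Finset.sum_const, Finset.card_univ, Fintype.card_coe,
      Finset.card_finsuppAntidiag_nat_eq_choose, Finset.card_univ, Fintype.card_fin, smul_eq_mul]

/-- The normalized Haar function of a box. -/
noncomputable def haar (R : BoxIndex d L) : EuclideanSpace ℝ (Fin d → Fin (4 ^ (L + 1))) :=
  tensor fun k t => (haarStep (quarter L (R.scale k)) (R.pos k) t : ℝ) / 2 ^ (L - R.scale k + 1)

/-- The normalized bump function of a box. -/
noncomputable def bump (R : BoxIndex d L) : EuclideanSpace ℝ (Fin d → Fin (4 ^ (L + 1))) :=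
  tensor fun k t => (bumpStep (quarter L (R.scale k)) (R.pos k) t : ℝ) / 2 ^ (L - R.scale k + 1)

theorem cast_quarter (a : ℕ) : (quarter L a : ℝ) = 2 ^ (L - a) * 2 ^ (L - a) := by
  rw [quarter, ← mul_pow]; norm_num

theorem sum_fin_div_mul_div (m : ℕ) (u w : ℕ → ℤ) (α β : ℝ) :
    ∑ t : Fin m, ((u t : ℝ) / α) * ((w t : ℝ) / β) =
      ((∑ t ∈ Finset.range m, u t * w t : ℤ) : ℝ) / (α * β) := by
  rw [← Fin.sum_univ_eq_sum_range (fun t => u t * w t)]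
  push_cast
  rw [Finset.sum_div]
  exact Finset.sum_congr rfl fun _ _ => div_mul_div_comm _ _ _ _

open scoped InnerProductSpace

theorem orthonormal_haar : Orthonormal ℝ (haar : BoxIndex d L → _) := by
  classical
  rw [orthonormal_iff_ite]
  intro R R'
  rw [haar, haar, inner_tensor]
  simp only [sum_fin_div_mul_div]
  split_ifs with h
  · subst h
    refine Finset.prod_eq_one fun k _ => ?_
    rw [sum_haarStep_mul_self (block_end_le (R.scale_le k) (R.pos_lt k))]
    push_cast
    rw [cast_quarter, pow_succ]
    field_simp
    norm_num
  · obtain ⟨k, hk⟩ := exists_ne_of_ne h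
    refine Finset.prod_eq_zero (Finset.mem_univ k) ?_
    rw [sum_haarStep_mul_haarStep_eq_zero (R.scale_le k) (R'.scale_le k) (R.pos_lt k)
      (R'.pos_lt k) (hk.imp (fun h => h.ne') And.right)]
    simp

theorem orthonormal_bump : Orthonormal ℝ (bump : BoxIndex d L → _) := by
  classical
  rw [orthonormal_iff_ite]
  intro R R'
  rw [bump, bump, inner_tensor]
  simp only [sum_fin_div_mul_div]
  split_ifs with h
  · subst h
    refine Finset.prod_eq_one fun k _ => ?_
    rw [sum_bumpStep_mul_self (block_end_le (R.scale_le k) (R.pos_lt k))]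
    push_cast
    rw [cast_quarter, pow_succ]
    field_simp
    norm_num
  · obtain ⟨k, hk⟩ := exists_ne_of_ne h
    refine Finset.prod_eq_zero (Finset.mem_univ k) ?_
    rw [sum_bumpStep_mul_bumpStep_eq_zero (R.scale_le k) (R'.scale_le k) (R.pos_lt k)
      (R'.pos_lt k) (hk.imp (fun h => h.ne') And.right)]
    simp

theorem sum_fin_ite_le_div {m : ℕ} (w : ℕ → ℤ) (β : ℝ) (t : Fin m) :
    (∑ s : Fin m, if s ≤ t then (w s : ℝ) / β else 0) =
      ((∑ s ∈ Finset.range (t + 1), w s : ℤ) : ℝ) / β := by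
  rw [Int.cast_sum, Finset.sum_div]
  simp only [Fin.le_def]
  rw [Fin.sum_univ_eq_sum_range (fun s => if s ≤ (t : ℕ) then (w s : ℝ) / β else 0),
    ← Finset.sum_filter]
  refine Finset.sum_congr ?_ fun _ _ => rfl
  ext s
  have := t.2
  simp only [Finset.mem_filter, Finset.mem_range]
  omega

/-- On the diagonal, a side with quarter length `l` contributes `2 * l ^ 2 / (4 * l) = l / 2`. As
the scales sum to `L`, the product of these factors is the same for every box. -/
theorem sum_haar_mul_inner_bump_dominating [DecidableEq (BoxIndex d L)] (R R' : BoxIndex d L) :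
    ∑ p, haar R' p * ⟪bump R, dominating p⟫_ℝ =
      if R = R' then (4 : ℝ) ^ (d * L - L) / 2 ^ d else 0 := by
  rw [haar, bump, sum_tensor_mul_inner_dominating]
  simp only [sum_fin_ite_le_div, sum_range_haarStep, sum_fin_div_mul_div]
  split_ifs with h
  · subst h
    trans ∏ k, (4 : ℝ) ^ (L - R.scale k) / 2
    · refine Finset.prod_congr rfl fun k _ => ?_
      rw [sum_bumpStep_mul_tent_self (block_end_le (R.scale_le k) (R.pos_lt k)),
        show (4 : ℝ) ^ (L - R.scale k) = 2 ^ (L - R.scale k) * 2 ^ (L - R.scale k) by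
          rw [← mul_pow]; norm_num]
      push_cast
      rw [cast_quarter, pow_succ]
      field_simp
      ring
    · rw [Finset.prod_div_distrib, Finset.prod_pow_eq_pow_sum, Finset.prod_const, Finset.card_univ,
        Fintype.card_fin]
      congr 2
      have h1 : ∑ k, (L - R.scale k) + ∑ k, R.scale k = d * L := by
        rw [← Finset.sum_add_distrib, Finset.sum_congr rfl
          fun k _ => Nat.sub_add_cancel (R.scale_le k)]
        simp
      rw [R.sum_scale] at h1
      omega
  · obtain ⟨k, hk⟩ := exists_ne_of_ne h
    refine Finset.prod_eq_zero (Finset.mem_univ k) ?_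
    rw [sum_bumpStep_mul_tent_eq_zero (R.scale_le k) (R.pos_lt k) hk]
    simp

end BoxIndex

/-! ### A grid subset with large mean square discrepancy -/

open Classical in
/-- Some set of points of the grid has only colourings of large mean square discrepancy. -/
theorem exists_grid_subset_signed_sum_large {d L : ℕ} (hd : 1 ≤ d) (hL : 1 ≤ L) :
    ∃ S : Finset (Fin d → Fin (4 ^ (L + 1))), ∀ χ : (Fin d → Fin (4 ^ (L + 1))) → ℤ,
      (∀ p, χ p = 1 ∨ χ p = -1) →
      ((((L : ℝ) + 1) ^ (d - 1)) / ((d - 1).factorial * 352 * 8 ^ d)) ^ 2 * (4 ^ (L + 1)) ^ d ≤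
        ∑ x : Fin d → Fin (4 ^ (L + 1)), (∑ p ∈ S, if p ≤ x then (χ p : ℝ) else 0) ^ 2 := by
  set B : ℝ := ((L : ℝ) + 1) ^ (d - 1) with hB
  set k := Fintype.card (BoxIndex d L) / 2 with hk
  have hcard := BoxIndex.card_eq (d := d) (L := L)
  have hchoose : 0 < (d + L - 1).choose L := Nat.choose_pos (by omega)
  have h4 : 4 ≤ 4 ^ L := by simpa using Nat.pow_le_pow_right (by norm_num : 0 < 4) hL
  have hcard4 : 4 ≤ Fintype.card (BoxIndex d L) := by rw [hcard]; nlinarith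
  have hk0 : 0 < k := by omega
  have hk4 : (Fintype.card (BoxIndex d L) : ℝ) ≤ 4 * k := by
    exact_mod_cast (by omega : Fintype.card (BoxIndex d L) ≤ 4 * k)
  have hf : (0 : ℝ) < (d - 1).factorial := by exact_mod_cast Nat.factorial_pos _
  have hBk : B * 4 ^ L ≤ 4 * (d - 1).factorial * k := by
    have h1 := Nat.pow_le_choose (α := ℝ) (d - 1) (d + L - 1)
    rw [div_le_iff₀ hf, show d + L - 1 + 1 - (d - 1) = L + 1 by omega,
      Nat.choose_symm_of_eq_add (show d + L - 1 = (d - 1) + L by omega)] at h1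
    push_cast at h1
    rw [hcard] at hk4
    push_cast at hk4
    calc B * 4 ^ L ≤ ((d + L - 1).choose L * (d - 1).factorial) * 4 ^ L := by gcongr
      _ = ((d + L - 1).choose L * 4 ^ L) * (d - 1).factorial := by ring
      _ ≤ (4 * k) * (d - 1).factorial := by gcongr
      _ = _ := by ring
  set σ : ℝ := (4 : ℝ) ^ (d * L - L) / 2 ^ d with hσ
  have hσ0 : 0 < σ := by positivity
  set N : ℝ := (4 ^ (L + 1)) ^ d with hN
  have hN0 : 0 < N := by positivity
  have hcardN : (Fintype.card (Fin d → Fin (4 ^ (L + 1))) : ℝ) = N := by simp [hN]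
  -- Here `N = 4 ^ L * 8 ^ d * σ` and `352 = 4 * 88`; the value 88 is chosen so that `88 ^ 2 = 7744`
  -- exceeds 7688.
  have hmain : B / ((d - 1).factorial * 352 * 8 ^ d) * N ≤ σ * k / 88 := by
    have hNσ : N * 2 ^ d * σ⁻¹ = 4 ^ L * 8 ^ d * 2 ^ d := by
      have h1 : (4 : ℝ) ^ (d * L - L) * 4 ^ L = 4 ^ (d * L) := by
        rw [← pow_add]; congr 1; have := Nat.mul_le_mul_right L hd; omega
      have h2 : N = 4 ^ (d * L) * 4 ^ d := by rw [hN, ← pow_mul, ← pow_add]; congr 1; ring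
      have h3 : (8 : ℝ) ^ d = 4 ^ d * 2 ^ d := by rw [← mul_pow]; norm_num
      rw [h2, ← h1, hσ, h3]
      field_simp
    have hN' : N = 4 ^ L * 8 ^ d * σ := by
      field_simp at hNσ
      linarith
    rw [div_mul_eq_mul_div, div_le_div_iff₀ (by positivity) (by norm_num), hN']
    calc B * (4 ^ L * 8 ^ d * σ) * 88 = (B * 4 ^ L) * (88 * 8 ^ d * σ) := by ring
      _ ≤ (4 * (d - 1).factorial * k) * (88 * 8 ^ d * σ) := by gcongr
      _ = _ := by ring
  set δ := Real.sqrt (σ ^ 2 * k / N) with hδ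
  have hδ2 : δ ^ 2 = σ ^ 2 * k / N := Real.sq_sqrt (by positivity)
  have hδ0 : 0 < δ := Real.sqrt_pos.2 (by positivity)
  obtain ⟨p, hp⟩ := exists_greedy_sequence (dominating (d := d) (m := 4 ^ (L + 1))) k δ
    fun W hW => by
      obtain ⟨p, hp⟩ := exists_far_from_subspace dominating
        (Submodule.span ℝ (Set.range (BoxIndex.bump : BoxIndex d L → _))) (σ ^ 2)
        (sq_mul_norm_sq_le_sum_inner_sq _ _ BoxIndex.orthonormal_bump BoxIndex.haar
          BoxIndex.orthonormal_haar σ BoxIndex.sum_haar_mul_inner_bump_dominating)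
        (by positivity) k (by
          rw [finrank_span_eq_card BoxIndex.orthonormal_bump.linearIndependent]; omega) W hW
      refine ⟨p, fun w hw => Real.sqrt_le_iff.2 ⟨norm_nonneg _, ?_⟩⟩
      rw [← hcardN]
      exact hp w hw
  -- A repeated point would have distance zero to the span of its predecessors. Injectivity turns
  -- the chosen index set into a set of grid points.
  have hinj : Function.Injective p := by
    have hne : ∀ i j, i < j → p i ≠ p j := fun i j hij hpe => by
      have := hp j (dominating (p i)) (Submodule.subset_span ⟨i, hij, rfl⟩)
      rw [hpe, sub_self, norm_zero] at this
      exact absurd hδ0 (not_lt.2 this)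
    intro i j hpe
    rcases lt_trichotomy i j with h | h | h
    exacts [absurd hpe (hne i j h), h, absurd hpe.symm (hne j i h)]
  obtain ⟨S, hS⟩ := exists_subset_signed_sum_large hk0 _ δ hδ0 hp
  refine ⟨S.map ⟨p, hinj⟩, fun χ hχ => ?_⟩
  have h1 := hS (fun i => χ (p i)) fun i => hχ _
  rw [EuclideanSpace.norm_sq_eq] at h1
  have h2 : ∀ x, (∑ i ∈ S, (χ (p i) : ℝ) • (dominating ∘ p) i) x =
      ∑ q ∈ S.map ⟨p, hinj⟩, if q ≤ x then (χ q : ℝ) else 0 := by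
    intro x
    rw [Finset.sum_map, WithLp.ofLp_sum, Finset.sum_apply]
    refine Finset.sum_congr rfl fun i _ => ?_
    simp [dominating]
  simp only [h2, Real.norm_eq_abs, sq_abs] at h1
  refine le_trans ?_ h1
  rw [hδ2, div_mul_eq_mul_div, div_div, le_div_iff₀ (by positivity)]
  have h3 := pow_le_pow_left₀ (by positivity) hmain 2
  rw [div_pow (σ * k), le_div_iff₀ (by norm_num)] at h3
  have h4 : 0 ≤ (B / ((d - 1).factorial * 352 * 8 ^ d)) ^ 2 * N ^ 2 := by positivity
  nlinarith

/-! ### Transfer from grid corners to Lebesgue weights -/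

section Grid

open MeasureTheory

theorem mem_boxTrace {d : ℕ} {P : Finset (Fin d → ℝ)} {x : Fin d → ℝ} {q : P} :
    q ∈ boxTrace P x ↔ 0 ≤ (q : Fin d → ℝ) ∧ (q : Fin d → ℝ) ≤ x := by
  classical
  simp [boxTrace, anchoredBox]

theorem measurableSet_cornerSet {d : ℕ} (P : Finset (Fin d → ℝ)) (F : Finset P) :
    MeasurableSet {x : Fin d → ℝ | x ∈ Set.Icc (0 : Fin d → ℝ) 1 ∧ boxTrace P x = F} := by
  have h : {x : Fin d → ℝ | x ∈ Set.Icc (0 : Fin d → ℝ) 1 ∧ boxTrace P x = F} =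
      Set.Icc 0 1 ∩ ⋂ q : P, {x | (q : Fin d → ℝ) ∈ anchoredBox x ↔ q ∈ F} := by
    ext x
    simp [boxTrace, Finset.ext_iff]
  rw [h]
  refine measurableSet_Icc.inter (MeasurableSet.iInter fun q => ?_)
  have hq : MeasurableSet {x : Fin d → ℝ | (q : Fin d → ℝ) ∈ anchoredBox x} := by
    have : {x : Fin d → ℝ | (q : Fin d → ℝ) ∈ anchoredBox x} =
        {_x | 0 ≤ (q : Fin d → ℝ)} ∩ Set.Ici (q : Fin d → ℝ) := by
      ext x
      simp [anchoredBox]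
    rw [this]
    exact (MeasurableSet.const _).inter measurableSet_Ici
  exact hq.iff (MeasurableSet.const _)

theorem cornerSet_ne_top {d : ℕ} (P : Finset (Fin d → ℝ)) (F : Finset P) :
    volume {x : Fin d → ℝ | x ∈ Set.Icc (0 : Fin d → ℝ) 1 ∧ boxTrace P x = F} ≠ ⊤ :=
  ((measure_mono fun _ h => h.1).trans_lt
    (isCompact_Icc (a := (0 : Fin d → ℝ)) (b := 1)).measure_lt_top).ne

theorem sum_cornerWeight_le_one {d : ℕ} (P : Finset (Fin d → ℝ)) (T : Finset (Finset P)) :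
    ∑ F ∈ T, cornerWeight P F ≤ 1 := by
  have h1 := measureReal_biUnion_finset (μ := (volume : Measure (Fin d → ℝ))) (s := T)
    (f := fun F => {x : Fin d → ℝ | x ∈ Set.Icc (0 : Fin d → ℝ) 1 ∧ boxTrace P x = F})
    (fun F _ F' _ hne => Set.disjoint_left.2 fun x hx hx' => hne (hx.2.symm.trans hx'.2))
    (fun F _ => measurableSet_cornerSet P F) (fun F _ => cornerSet_ne_top P F)
  refine h1.symm.le.trans ?_
  calc _ ≤ volume.real (Set.Icc (0 : Fin d → ℝ) 1) :=
        measureReal_mono (Set.iUnion₂_subset fun _ _ _ hx => hx.1)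
          isCompact_Icc.measure_lt_top.ne
    _ = 1 := by
      rw [measureReal_def, Real.volume_Icc_pi_toReal zero_le_one]
      simp

/-- The embedding of the `m × ⋯ × m` grid into the unit cube. -/
noncomputable def gridPoint {d m : ℕ} (p : Fin d → Fin m) (k : Fin d) : ℝ := (p k : ℕ) / m

/-- The half-open cell of side `1 / m` with smallest corner `gridPoint c`. -/
def gridCell {d m : ℕ} (c : Fin d → Fin m) : Set (Fin d → ℝ) :=
  Set.univ.pi fun k => Set.Ico (((c k : ℕ) : ℝ) / m) ((((c k : ℕ) : ℝ) + 1) / m)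

variable {d m : ℕ}

theorem gridPoint_le_iff_of_mem_gridCell {c p : Fin d → Fin m} {x : Fin d → ℝ}
    (hx : x ∈ gridCell c) : gridPoint p ≤ x ↔ p ≤ c := by
  simp only [gridCell, Set.mem_pi, Set.mem_univ, true_implies, Set.mem_Ico] at hx
  refine forall_congr' fun k => ?_
  have hm : (0 : ℝ) < m := by exact_mod_cast (c k).pos
  rw [Fin.le_def, gridPoint]
  constructor
  · intro h
    have h1 := h.trans_lt (hx k).2
    rw [div_lt_div_iff_of_pos_right hm] at h1
    exact Nat.lt_succ_iff.1 (by exact_mod_cast h1)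
  · intro h
    refine le_trans ?_ (hx k).1
    gcongr

theorem gridPoint_mem_gridCell (c : Fin d → Fin m) : gridPoint c ∈ gridCell c := by
  refine Set.mem_univ_pi.2 fun k => ⟨le_rfl, ?_⟩
  have hm : (0 : ℝ) < m := by exact_mod_cast (c k).pos
  rw [gridPoint]
  gcongr
  linarith

theorem gridPoint_nonneg (p : Fin d → Fin m) : 0 ≤ gridPoint p := fun k => by
  rw [gridPoint]; positivity

theorem gridPoint_injective : Function.Injective (gridPoint : (Fin d → Fin m) → Fin d → ℝ) :=
  fun p q h => le_antisymm
    ((gridPoint_le_iff_of_mem_gridCell (gridPoint_mem_gridCell q)).1 h.le)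
    ((gridPoint_le_iff_of_mem_gridCell (gridPoint_mem_gridCell p)).1 h.ge)

theorem gridCell_subset (c : Fin d → Fin m) : gridCell c ⊆ Set.Icc 0 1 := by
  intro x hx
  refine ⟨fun k => (gridPoint_nonneg c k).trans (hx k trivial).1, fun k => ?_⟩
  refine (hx k trivial).2.le.trans ?_
  have hm : (0 : ℝ) < m := by exact_mod_cast (c k).pos
  rw [Pi.one_apply, div_le_one hm]
  exact_mod_cast (c k).2

theorem gridPoint_mem_Icc (c : Fin d → Fin m) : gridPoint c ∈ Set.Icc (0 : Fin d → ℝ) 1 :=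
  gridCell_subset c (gridPoint_mem_gridCell c)

theorem disjoint_gridCell {c c' : Fin d → Fin m} (h : c ≠ c') :
    Disjoint (gridCell c) (gridCell c') :=
  Set.disjoint_left.2 fun _ hx hx' => h (le_antisymm
    ((gridPoint_le_iff_of_mem_gridCell hx').1 ((gridPoint_le_iff_of_mem_gridCell hx).2 le_rfl))
    ((gridPoint_le_iff_of_mem_gridCell hx).1 ((gridPoint_le_iff_of_mem_gridCell hx').2 le_rfl)))

theorem measureReal_gridCell (c : Fin d → Fin m) :
    volume.real (gridCell c) = 1 / (m : ℝ) ^ d := by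
  have hm : ∀ k : Fin d, (0 : ℝ) < m := fun k => by exact_mod_cast (c k).pos
  rw [measureReal_def, gridCell, Real.volume_pi_Ico_toReal
    (fun k => by have := hm k; change _ / _ ≤ _ / _; gcongr; linarith)]
  trans ∏ _k : Fin d, 1 / (m : ℝ)
  · exact Finset.prod_congr rfl fun k _ => by ring
  · simp

/-- The grid points indexed by `S`, as a finite subset of the unit cube. -/
noncomputable def gridSet (S : Finset (Fin d → Fin m)) : Finset (Fin d → ℝ) :=
  S.map ⟨gridPoint, gridPoint_injective⟩

theorem gridSet_subset (S : Finset (Fin d → Fin m)) :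
    (gridSet S : Set (Fin d → ℝ)) ⊆ Set.Icc 0 1 := by
  intro x hx
  obtain ⟨p, -, rfl⟩ := Finset.mem_map.1 (Finset.mem_coe.1 hx)
  exact gridPoint_mem_Icc p

/-- The trace is constant on half-open cells, so the average over grid corners computes the integral
over the cube. -/
theorem boxTrace_gridSet_of_mem_gridCell (S : Finset (Fin d → Fin m)) {c : Fin d → Fin m}
    {x : Fin d → ℝ} (hx : x ∈ gridCell c) :
    boxTrace (gridSet S) x = boxTrace (gridSet S) (gridPoint c) := by
  ext ⟨q, hq⟩
  obtain ⟨p, -, rfl⟩ := Finset.mem_map.1 hq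
  rw [mem_boxTrace, mem_boxTrace]
  exact and_congr_right fun _ => (gridPoint_le_iff_of_mem_gridCell hx).trans
    (gridPoint_le_iff_of_mem_gridCell (gridPoint_mem_gridCell c)).symm

open Classical in
theorem card_div_le_cornerWeight (S : Finset (Fin d → Fin m)) (F : Finset (gridSet S)) :
    ((Finset.univ.filter fun c : Fin d → Fin m =>
      boxTrace (gridSet S) (gridPoint c) = F).card : ℝ) / (m : ℝ) ^ d ≤
      cornerWeight (gridSet S) F := by
  have h1 := measureReal_biUnion_finset (μ := (volume : Measure (Fin d → ℝ)))
    (s := Finset.univ.filter fun c : Fin d → Fin m => boxTrace (gridSet S) (gridPoint c) = F)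
    (f := gridCell) (fun _ _ _ _ h => disjoint_gridCell h)
    (fun c _ => MeasurableSet.univ_pi fun _ => measurableSet_Ico)
    (fun c _ => ((measure_mono (gridCell_subset c)).trans_lt isCompact_Icc.measure_lt_top).ne)
  simp only [measureReal_gridCell, Finset.sum_const, nsmul_eq_mul, mul_one_div] at h1
  rw [← h1]
  refine measureReal_mono (Set.iUnion₂_subset fun c hc x hx => ⟨gridCell_subset c hx, ?_⟩)
    (cornerSet_ne_top _ F)
  rw [boxTrace_gridSet_of_mem_gridCell S hx]
  exact (Finset.mem_filter.1 hc).2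

theorem sum_div_le_sum_cornerWeight_mul (S : Finset (Fin d → Fin m))
    (φ : Finset (gridSet S) → ℝ) (hφ : ∀ F, 0 ≤ φ F) :
    (∑ c : Fin d → Fin m, φ (boxTrace (gridSet S) (gridPoint c))) / (m : ℝ) ^ d ≤
      ∑ F ∈ anchoredSystem (gridSet S), cornerWeight (gridSet S) F * φ F := by
  classical
  rw [← Finset.sum_fiberwise_of_maps_to (s := Finset.univ) (t := anchoredSystem (gridSet S))
    (g := fun c : Fin d → Fin m => boxTrace (gridSet S) (gridPoint c)) (fun c _ =>
      Finset.mem_filter.2 ⟨Finset.mem_univ _, gridPoint c, gridPoint_mem_Icc c, rfl⟩),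
    Finset.sum_div]
  refine Finset.sum_le_sum fun F _ => ?_
  rw [Finset.sum_congr rfl fun c hc => by rw [(Finset.mem_filter.1 hc).2], Finset.sum_const,
    nsmul_eq_mul, mul_div_right_comm]
  refine mul_le_mul_of_nonneg_right ?_ (hφ F)
  convert card_div_le_cornerWeight S F

open Classical in
theorem sum_boxTrace_gridSet (S : Finset (Fin d → Fin m)) (X : (Fin d → ℝ) → ℝ)
    (c : Fin d → Fin m) : ∑ j ∈ boxTrace (gridSet S) (gridPoint c), X j =
      ∑ p ∈ S, if p ≤ c then X (gridPoint p) else 0 := by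
  rw [boxTrace, Finset.sum_filter,
    Finset.sum_coe_sort (gridSet S) (fun q => if q ∈ anchoredBox (gridPoint c) then X q else 0),
    gridSet, Finset.sum_map]
  refine Finset.sum_congr rfl fun p _ => ?_
  simp only [anchoredBox, Set.mem_Icc, Function.Embedding.coeFn_mk, gridPoint_nonneg, true_and,
    gridPoint_le_iff_of_mem_gridCell (gridPoint_mem_gridCell c)]

open Classical in
/-- A lower bound for the mean square discrepancy over the grid bounds the weighted
`L_2`-discrepancy. -/
theorem le_weightedLpDisc_gridSet (hm : 0 < m) (S : Finset (Fin d → Fin m)) (K : ℝ)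
    (h : ∀ χ : (Fin d → Fin m) → ℤ, (∀ p, χ p = 1 ∨ χ p = -1) → K ^ 2 * (m : ℝ) ^ d ≤
      ∑ x : Fin d → Fin m, (∑ p ∈ S, if p ≤ x then (χ p : ℝ) else 0) ^ 2) :
    K ≤ weightedLpDisc 2 (anchoredSystem (gridSet S)) (cornerWeight (gridSet S)) := by
  have hN : (0 : ℝ) < (m : ℝ) ^ d := by positivity
  refine Finset.le_inf' _ _ fun χ hχ => ?_
  simp only [Fintype.mem_piFinset, Finset.mem_insert, Finset.mem_singleton] at hχ
  -- The colouring is extended to all points as an integer sign; the value 1 off the set is an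
  -- arbitrary default.
  have hX : ∀ q : Fin d → ℝ, ∃ z : ℤ, (z = 1 ∨ z = -1) ∧
      ∀ hq : q ∈ gridSet S, χ ⟨q, hq⟩ = z := by
    intro q
    by_cases hq : q ∈ gridSet S
    · rcases hχ ⟨q, hq⟩ with h1 | h1
      · exact ⟨-1, Or.inr rfl, fun _ => by simpa using h1⟩
      · exact ⟨1, Or.inl rfl, fun _ => by simpa using h1⟩
    · exact ⟨1, Or.inl rfl, fun h1 => absurd h1 hq⟩
  choose X hX1 hX2 using hX
  have hsum : ∀ c : Fin d → Fin m, ∑ j ∈ boxTrace (gridSet S) (gridPoint c), χ j =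
      ∑ p ∈ S, if p ≤ c then (X (gridPoint p) : ℝ) else 0 := fun c => by
    rw [← sum_boxTrace_gridSet S (fun q => (X q : ℝ)) c]
    exact Finset.sum_congr rfl fun j _ => hX2 j j.2
  have h1 := sum_div_le_sum_cornerWeight_mul S (fun F => |∑ j ∈ F, χ j| ^ (2 : ℝ))
    fun F => by positivity
  -- The constant function 1 shows that the total weight is at least 1, hence exactly 1, so the
  -- normalization disappears.
  have h2 := sum_div_le_sum_cornerWeight_mul S (fun _ => 1) fun _ => zero_le_one
  simp only [Finset.sum_const, Finset.card_univ, Fintype.card_pi, Fintype.card_fin,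
    Finset.prod_const, nsmul_eq_mul, mul_one, Nat.cast_pow, div_self hN.ne'] at h2
  have h3 := h (fun p => X (gridPoint p)) fun p => hX1 _
  have h4 : K ^ 2 ≤ (∑ c : Fin d → Fin m,
      |∑ j ∈ boxTrace (gridSet S) (gridPoint c), χ j| ^ (2 : ℝ)) / (m : ℝ) ^ d := by
    rw [le_div_iff₀ hN]
    simpa only [hsum, Real.rpow_two, sq_abs] using h3
  have h5 : ∑ F ∈ anchoredSystem (gridSet S), cornerWeight (gridSet S) F = 1 :=
    le_antisymm (sum_cornerWeight_le_one _ _) h2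
  rw [h5, div_one, one_mul, ← Real.sqrt_eq_rpow]
  exact Real.le_sqrt_of_sq_le (h4.trans h1)

end Grid

/-! ### Conclusion -/

theorem theorem6p1 (d : ℕ) (hd : 2 ≤ d) :
    ∃ c : ℝ, 0 < c ∧
      {n : ℕ | ∃ P : Finset (Fin d → ℝ),
        (P : Set (Fin d → ℝ)) ⊆ Set.Icc (0 : Fin d → ℝ) 1 ∧ P.card = n ∧
        c * Real.log n ^ (d - 1) ≤
          weightedLpDisc 2 (anchoredSystem P) (cornerWeight P)}.Infinite := by
  classical
  set b : ℝ := (d - 1).factorial * 352 * 8 ^ d with hb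
  have hb0 : 0 < b := by positivity
  have hd0 : (0 : ℝ) < d := by exact_mod_cast (by omega : 0 < d)
  refine ⟨1 / (b * (3 * d) ^ (d - 1)), by positivity, Set.infinite_of_forall_exists_gt fun a => ?_⟩
  obtain ⟨L, hL⟩ := exists_nat_gt (a * b + 1)
  have hL1 : 1 ≤ L := by
    have : (1 : ℝ) < L := lt_of_le_of_lt (by nlinarith [(Nat.cast_nonneg a : (0 : ℝ) ≤ a)]) hL
    exact_mod_cast this.le
  set m := 4 ^ (L + 1) with hm
  have hm0 : 0 < m := by positivity
  have hN : (0 : ℝ) < (m : ℝ) ^ d := by positivity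
  obtain ⟨S, hS⟩ := exists_grid_subset_signed_sum_large (d := d) (L := L) (by omega) hL1
  set K : ℝ := ((L : ℝ) + 1) ^ (d - 1) / b with hK
  have hK0 : 0 ≤ K := by positivity
  have hmN : ((m : ℝ)) ^ d = (4 ^ (L + 1)) ^ d := by rw [hm]; push_cast; rfl
  rw [← hmN] at hS
  have hcard : (gridSet S).card = S.card := Finset.card_map _
  -- The size of `S` is not known exactly. Testing the constant colouring, whose sums never exceed
  -- `S.card`, shows that it is unbounded as `L` grows.
  have hKS : K ≤ S.card := by
    have h1 := hS (fun _ => 1) fun _ => Or.inl rfl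
    have h2 : ∑ x : Fin d → Fin m, (∑ p ∈ S, if p ≤ x then ((1 : ℤ) : ℝ) else 0) ^ 2 ≤
        (S.card : ℝ) ^ 2 * (m : ℝ) ^ d := by
      calc _ ≤ ∑ x : Fin d → Fin m, (S.card : ℝ) ^ 2 := by
            refine Finset.sum_le_sum fun x _ => ?_
            refine pow_le_pow_left₀ (Finset.sum_nonneg fun p _ => by split_ifs <;> simp) ?_ 2
            rw [← nsmul_one, ← Finset.sum_const]
            exact Finset.sum_le_sum fun p _ => by split_ifs <;> simp
        _ = _ := by simp [mul_comm]
    exact le_of_sq_le_sq (le_of_mul_le_mul_right (h1.trans h2) hN) (Nat.cast_nonneg _)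
  have haK : (a : ℝ) < K := by
    rw [hK, lt_div_iff₀ hb0]
    have : (L : ℝ) + 1 ≤ ((L : ℝ) + 1) ^ (d - 1) :=
      le_self_pow₀ (by linarith [(Nat.cast_nonneg L : (0 : ℝ) ≤ L)]) (by omega)
    linarith
  have haS : a < S.card := by exact_mod_cast haK.trans_le hKS
  refine ⟨S.card, ⟨gridSet S, gridSet_subset S, hcard, ?_⟩, haS⟩
  refine le_trans ?_ (le_weightedLpDisc_gridSet hm0 S K fun χ hχ => by convert hS χ hχ)
  have hS1 : (1 : ℝ) ≤ S.card := by exact_mod_cast (by omega : 1 ≤ S.card)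
  -- The size of the whole grid bounds `S.card`, and `log 4 ≤ 3`.
  have hlog : Real.log S.card ≤ 3 * d * (L + 1) := by
    have h1 : (S.card : ℝ) ≤ 4 ^ ((L + 1) * d) := by
      have := Finset.card_le_univ S
      rw [Fintype.card_pi] at this
      simp only [Fintype.card_fin, Finset.prod_const, Finset.card_univ] at this
      rw [← pow_mul] at this
      exact_mod_cast this
    have h2 := Real.log_le_log (by linarith) h1
    have h3 := Real.log_le_sub_one_of_pos (by norm_num : (0 : ℝ) < 4)
    rw [Real.log_pow] at h2
    push_cast at h2
    nlinarith [mul_pos (by positivity : (0 : ℝ) < (L : ℝ) + 1) hd0]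
  calc _ ≤ 1 / (b * (3 * d) ^ (d - 1)) * (3 * d * (L + 1)) ^ (d - 1) := by
        gcongr
    _ = K := by
        rw [hK, mul_pow (3 * (d : ℝ)) (L + 1)]
        field_simp
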